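/- For a commutative unital ring $R$ whose additive group is finitely generated and torsion-free, write $\mathbb{Q}R:=\mathbb{Q}\otimes_{\mathbb{Z}}R\supseteq R$, let $(\mathbb{Q}R)^*$ be its group of units, and let $R^\times$ be the multiplicative monoid of non-zerodivisors of $R$, acting on the additive group of $R$ by multiplication. Let $\mathcal{C}$ be the smallest family of additive subgroups of $R$ that contains $R$ and satisfies $sC\in\mathcal{C}$ and $s^{-1}C:=\{a\in R: sa\in C\}\in\mathcal{C}$ for all $s\in R^\times$, $C\in\mathcal{C}$, and let $\overline{R}:=\varprojlim_{C\in\mathcal{C}}R/C$, with the inverse limit topology (each $R/C$ being discrete). The discrete group $\mathbb{Q}R\rtimes(\mathbb{Q}R)^*$ acts on $\mathbb{Q}R$ by affine maps $(z,\gamma).x=z+\gamma x$. Restricting each $g$ to the partial bijection $R\cap g^{-1}.R\to g.R\cap R$ gives a partial action on $R$. It extends by continuity to a partial action on $\overline{R}$ by homeomorphisms between open subsets: the graph of the extension of $g$ is the closure in $\overline{R}\times\overline{R}$ of the image of the graph of the partial bijection. Let $(\mathbb{Q}R\rtimes(\mathbb{Q}R)^*)\ltimes\overline{R}$ be the associated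 transformation groupoid: its arrows are the pairs $(g,x)$ with $x\in\overline{R}$ in the domain of $g$, with source $x$, range $g.x$, product $(g,h.x)(h,x)=(gh,x)$, and the subspace topology from $(\mathbb{Q}R\rtimes(\mathbb{Q}R)^*)\times\overline{R}$. \textbf{Theorem.} Let $R_1$ and $R_2$ be commutative unital rings whose additive groups are finitely generated and torsion-free. If $(\mathbb{Q}R_1\rtimes(\mathbb{Q}R_1)^*)\ltimes\overline{R}_1$ and $(\mathbb{Q}R_2\rtimes(\mathbb{Q}R_2)^*)\ltimes\overline{R}_2$ are isomorphic as topological groupoids, then $\mathbb{Q}\otimes_{\mathbb{Z}}R_1$ and $\mathbb{Q}\otimes_{\mathbb{Z}}R_2$ are isomorphic as $\mathbb{Q}$-algebras. -/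

import Mathlib

open scoped nonZeroDivisors TensorProduct Topology

universe u v

namespace AlgAction

section TopologicalGroupoids

/-- A topological groupoid: a space of objects (units), a space of arrows, and continuous structure
maps; the product `mul a b h` (first `b`, then `a`) is defined when the source of `a` is the range
of `b`. -/
structure TopGroupoid where
  Obj : Type u
  Arr : Type u
  topObj : TopologicalSpace Obj
  topArr : TopologicalSpace Arr
  src : Arr → Obj
  tgt : Arr → Obj
  one : Obj → Arr
  inv : Arr → Arr
  mul : (a b : Arr) → src a = tgt b → Arr
  src_one : ∀ x, src (one x) = x
  tgt_one : ∀ x, tgt (one x) = x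
  src_inv : ∀ a, src (inv a) = tgt a
  tgt_inv : ∀ a, tgt (inv a) = src a
  src_mul : ∀ a b h, src (mul a b h) = src b
  tgt_mul : ∀ a b h, tgt (mul a b h) = tgt a
  mul_assoc : ∀ a b c (hab : src a = tgt b) (hbc : src b = tgt c),
    mul (mul a b hab) c ((src_mul a b hab).trans hbc) =
      mul a (mul b c hbc) (hab.trans (tgt_mul b c hbc).symm)
  one_mul : ∀ a, mul (one (tgt a)) a (src_one _) = a
  mul_one : ∀ a, mul a (one (src a)) (tgt_one _).symm = a
  inv_mul : ∀ a, mul (inv a) a (src_inv a) = one (src a)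
  mul_inv : ∀ a, mul a (inv a) (tgt_inv a).symm = one (tgt a)
  continuous_src : Continuous src
  continuous_tgt : Continuous tgt
  continuous_one : Continuous one
  continuous_inv : Continuous inv
  continuous_mul : Continuous fun p : {p : Arr × Arr // src p.1 = tgt p.2} => mul p.1.1 p.1.2 p.2

attribute [instance] TopGroupoid.topObj TopGroupoid.topArr

/-- An isomorphism of topological groupoids: homeomorphisms of the object and arrow spaces that
are compatible with source, range and product (hence also with units and inverses). -/
structure TopGroupoid.Iso (G : TopGroupoid.{u}) (H : TopGroupoid.{v}) where
  obj : G.Obj ≃ₜ H.Obj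
  arr : G.Arr ≃ₜ H.Arr
  src_arr : ∀ a, H.src (arr a) = obj (G.src a)
  tgt_arr : ∀ a, H.tgt (arr a) = obj (G.tgt a)
  arr_mul : ∀ a b (h : G.src a = G.tgt b),
    arr (G.mul a b h) =
      H.mul (arr a) (arr b) ((src_arr a).trans ((congrArg obj h).trans (tgt_arr b).symm))

end TopologicalGroupoids

section PartialActions

/-- A partial action of a discrete group `G` on a space `X` by partial homeomorphisms: `dom g` is
the open domain of `g` and `act g x hx` is the value `g.x` for `x` in that domain. The inverse of
the partial map of `g` is the one of `g⁻¹`, and the one of `g * h` extends the composite. -/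
structure PartialAction (G : Type*) [Group G] (X : Type*) [TopologicalSpace X] where
  dom : G → Set X
  act : (g : G) → (x : X) → x ∈ dom g → X
  isOpen_dom : ∀ g, IsOpen (dom g)
  continuous_act : ∀ g, Continuous fun x : dom g => act g x.1 x.2
  mem_dom_one : ∀ x, x ∈ dom 1
  act_one : ∀ x, act 1 x (mem_dom_one x) = x
  mem_dom_inv : ∀ g x hx, act g x hx ∈ dom g⁻¹
  act_inv : ∀ g x hx, act g⁻¹ (act g x hx) (mem_dom_inv g x hx) = x
  mem_dom_mul : ∀ g h x hx, act h x hx ∈ dom g → x ∈ dom (g * h)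
  act_mul : ∀ g h x hx hy, act (g * h) x (mem_dom_mul g h x hx hy) = act g (act h x hx) hy

variable {G : Type u} [Group G] {X : Type u} [TopologicalSpace X]

/-- The arrows of the transformation groupoid `G ⋉ X`: pairs `(g, x)` with `x` in the domain
of `g`. -/
def PartialAction.Arrow (θ : PartialAction G X) : Type u := {p : G × X // p.2 ∈ θ.dom p.1}

/-- Subspace topology from `G × X`, where `G` is discrete. -/
instance (θ : PartialAction G X) : TopologicalSpace θ.Arrow :=
  letI : TopologicalSpace G := ⊥
  instTopologicalSpaceSubtype

namespace PartialAction

variable (θ : PartialAction G X)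

theorem arrow_ext {a b : θ.Arrow} (h1 : a.1.1 = b.1.1) (h2 : a.1.2 = b.1.2) : a = b :=
  Subtype.ext (Prod.ext h1 h2)

theorem act_congr {g g' : G} {x x' : X} (hg : g = g') (hx : x = x') (h : x ∈ θ.dom g) :
    θ.act g x h = θ.act g' x' (by subst hg hx; exact h) := by
  subst hg hx; rfl

/-- The product of composable arrows: `(g, h.x)(h, x) = (gh, x)`. -/
def arrowMul (a b : θ.Arrow) (e : a.1.2 = θ.act b.1.1 b.1.2 b.2) : θ.Arrow :=
  ⟨(a.1.1 * b.1.1, b.1.2), θ.mem_dom_mul _ _ _ b.2 (e ▸ a.2)⟩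

/-- The inverse of an arrow: `(g, x)⁻¹ = (g⁻¹, g.x)`. -/
def arrowInv (a : θ.Arrow) : θ.Arrow :=
  ⟨(a.1.1⁻¹, θ.act a.1.1 a.1.2 a.2), θ.mem_dom_inv _ _ _⟩

theorem act_arrowMul (a b : θ.Arrow) (e : a.1.2 = θ.act b.1.1 b.1.2 b.2) :
    θ.act (θ.arrowMul a b e).1.1 (θ.arrowMul a b e).1.2 (θ.arrowMul a b e).2 =
      θ.act a.1.1 a.1.2 a.2 :=
  (θ.act_mul a.1.1 b.1.1 b.1.2 b.2 (e ▸ a.2)).trans (θ.act_congr rfl e.symm _)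

theorem continuous_fst_arrow :
    letI : TopologicalSpace G := ⊥
    Continuous fun a : θ.Arrow => a.1.1 := by
  let _ : TopologicalSpace G := ⊥
  exact continuous_fst.comp continuous_subtype_val

theorem continuous_snd_arrow : Continuous fun a : θ.Arrow => a.1.2 := by
  let _ : TopologicalSpace G := ⊥
  exact continuous_snd.comp continuous_subtype_val

theorem continuous_act_arrow : Continuous fun a : θ.Arrow => θ.act a.1.1 a.1.2 a.2 := by
  let _ : TopologicalSpace G := ⊥
  have : DiscreteTopology G := ⟨rfl⟩
  rw [continuous_iff_continuousAt]
  intro a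
  have hU : IsOpen {b : θ.Arrow | b.1.1 = a.1.1} :=
    (isOpen_discrete {a.1.1}).preimage θ.continuous_fst_arrow
  have hc : ContinuousOn (fun b : θ.Arrow => θ.act b.1.1 b.1.2 b.2)
      {b : θ.Arrow | b.1.1 = a.1.1} := by
    rw [continuousOn_iff_continuous_domRestrict]
    have hm : ∀ b : {b : θ.Arrow | b.1.1 = a.1.1}, b.1.1.2 ∈ θ.dom a.1.1 := fun b => by
      have h := b.1.2
      rwa [b.2] at h
    have := (θ.continuous_act a.1.1).comp
      ((θ.continuous_snd_arrow.comp continuous_subtype_val).subtype_mk hm)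
    exact this.congr fun b => θ.act_congr (b.2 : b.1.1.1 = a.1.1).symm rfl _
  exact hc.continuousAt (hU.mem_nhds rfl)

theorem continuous_arrowMk {Y : Type*} [TopologicalSpace Y] (f : Y → θ.Arrow)
    (h1 : letI : TopologicalSpace G := ⊥; Continuous fun y => (f y).1.1)
    (h2 : Continuous fun y => (f y).1.2) : Continuous f := by
  let _ : TopologicalSpace G := ⊥
  exact continuous_induced_rng.mpr (h1.prodMk h2)

/-- The (partial) transformation groupoid `G ⋉ X` of a partial action: arrows `(g, x)` with `x` in
the domain of `g`, source `x`, range `g.x`, product `(g, h.x)(h, x) = (gh, x)`. -/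
def groupoid : TopGroupoid.{u} where
  Obj := X
  Arr := θ.Arrow
  topObj := inferInstance
  topArr := inferInstance
  src a := a.1.2
  tgt a := θ.act a.1.1 a.1.2 a.2
  one x := ⟨(1, x), θ.mem_dom_one x⟩
  inv := θ.arrowInv
  mul := θ.arrowMul
  src_one _ := rfl
  tgt_one := θ.act_one
  src_inv _ := rfl
  tgt_inv a := θ.act_inv _ _ _
  src_mul _ _ _ := rfl
  tgt_mul := θ.act_arrowMul
  mul_assoc _ _ _ _ _ := θ.arrow_ext (mul_assoc _ _ _) rfl
  one_mul _ := θ.arrow_ext (one_mul _) rfl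
  mul_one _ := θ.arrow_ext (mul_one _) rfl
  inv_mul _ := θ.arrow_ext (inv_mul_cancel _) rfl
  mul_inv _ := θ.arrow_ext (mul_inv_cancel _) rfl
  continuous_src := θ.continuous_snd_arrow
  continuous_tgt := θ.continuous_act_arrow
  continuous_one := by
    let _ : TopologicalSpace G := ⊥
    exact θ.continuous_arrowMk (fun x => ⟨(1, x), θ.mem_dom_one x⟩) continuous_const continuous_id
  continuous_inv := by
    let _ : TopologicalSpace G := ⊥
    have : DiscreteTopology G := ⟨rfl⟩
    exact θ.continuous_arrowMk θ.arrowInv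
      ((continuous_of_discreteTopology (f := fun g : G => g⁻¹)).comp θ.continuous_fst_arrow)
      θ.continuous_act_arrow
  continuous_mul := by
    let _ : TopologicalSpace G := ⊥
    have : DiscreteTopology G := ⟨rfl⟩
    refine θ.continuous_arrowMk (fun p : {p : θ.Arrow × θ.Arrow //
      p.1.1.2 = θ.act p.2.1.1 p.2.1.2 p.2.2} => θ.arrowMul p.1.1 p.1.2 p.2) ?_ ?_
    · exact (continuous_of_discreteTopology (f := fun p : G × G => p.1 * p.2)).comp
        ((θ.continuous_fst_arrow.comp (continuous_fst.comp continuous_subtype_val)).prodMk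
          (θ.continuous_fst_arrow.comp (continuous_snd.comp continuous_subtype_val)))
    · have h : Continuous fun p : {p : θ.Arrow × θ.Arrow //
          p.1.1.2 = θ.act p.2.1.1 p.2.1.2 p.2.2} => p.1.2.1.2 :=
        θ.continuous_snd_arrow.comp (continuous_snd.comp continuous_subtype_val)
      exact h

end PartialAction

end PartialActions

section Completions

variable (S : Type*) (A : Type u) [Monoid S] [AddCommGroup A] [DistribMulAction S A]

/-- The `S`-constructible subgroups of `A`: the smallest family of subgroups that contains `A` and
is closed under images and preimages under the maps `a ↦ s • a`. -/
inductive IsConstructible : AddSubgroup A → Prop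
  | top : IsConstructible ⊤
  | image (s : S) {C : AddSubgroup A} : IsConstructible C →
      IsConstructible (C.map (DistribSMul.toAddMonoidHom A s))
  | preimage (s : S) {C : AddSubgroup A} : IsConstructible C →
      IsConstructible (C.comap (DistribSMul.toAddMonoidHom A s))

/-- The constructible subgroups as a type. -/
abbrev Constructible : Type u := {C : AddSubgroup A // IsConstructible S A C}

/-- The completion of `A`: the inverse limit of the quotients `A ⧸ C` over the constructible
subgroups `C`, ordered by inclusion. -/
def Completion : Type u :=
  {x : ∀ C : Constructible S A, A ⧸ C.1 //
    ∀ (C D : Constructible S A) (h : C.1 ≤ D.1), AddSubgroup.quotientMapOfLE h (x C) = x D}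

/-- The inverse limit topology, each `A ⧸ C` being discrete. -/
instance : TopologicalSpace (Completion S A) :=
  letI : ∀ C : Constructible S A, TopologicalSpace (A ⧸ C.1) := fun _ => ⊥
  instTopologicalSpaceSubtype

variable {A}

/-- The canonical map from `A` to its completion. -/
def toCompletion (a : A) : Completion S A := ⟨fun _ => (a : A ⧸ _), fun _ _ _ => rfl⟩

end Completions

section Rings

variable (R : Type u) [CommRing R]

/-- The `ℚ`-algebra `ℚR = ℚ ⊗ R`. -/
abbrev RatAlg : Type u := ℚ ⊗[ℤ] R

/-- The completion of `R` for the multiplication action of the monoid `R⁰` of non-zerodivisors on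
the additive group of `R`. -/
abbrev RingCompletion : Type u := Completion R⁰ R

/-- The group `ℚR ⋊ (ℚR)ˣ`, the units acting on the additive group of `ℚR` by multiplication. -/
abbrev AffineGroup : Type u :=
  Multiplicative (RatAlg R) ⋊[(MulAutMultiplicative (RatAlg R)).symm.toMonoidHom.comp
    (DistribMulAction.toAddAut (RatAlg R)ˣ (RatAlg R))] (RatAlg R)ˣ

variable {R}

/-- The canonical map `R → ℚR`, `a ↦ 1 ⊗ a`. -/
abbrev toRat : R →+* RatAlg R := (Algebra.TensorProduct.includeRight : R →ₐ[ℤ] ℚ ⊗[ℤ] R).toRingHom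

/-- `ℚR ⋊ (ℚR)ˣ` acts on `ℚR` by affine maps: `(z, γ).x = z + γ x`. -/
instance : MulAction (AffineGroup R) (RatAlg R) where
  smul g x := g.left.toAdd + (g.right : RatAlg R) * x
  one_smul x := by
    change (0 : RatAlg R) + ((1 : (RatAlg R)ˣ) : RatAlg R) * x = x
    simp
  mul_smul g h x := by
    change (g.left.toAdd + (g.right : RatAlg R) * h.left.toAdd) +
      ((g.right * h.right : (RatAlg R)ˣ) : RatAlg R) * x =
      g.left.toAdd + (g.right : RatAlg R) * (h.left.toAdd + (h.right : RatAlg R) * x)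
    push_cast
    ring

theorem affine_smul_def (g : AffineGroup R) (x : RatAlg R) :
    g • x = g.left.toAdd + (g.right : RatAlg R) * x := rfl

/-- `Extends g x y` says that `g.x = y` for the extension of the partial action of `g` from `R` to
its completion: `(x, y)` lies in the closure of the graph of the partial bijection `a ↦ g.a`
of `R`, which is defined for the `a ∈ R` with `g.a ∈ R`. -/
def Extends (g : AffineGroup R) (x y : RingCompletion R) : Prop :=
  (x, y) ∈ closure {p : RingCompletion R × RingCompletion R |
    ∃ a b : R, g • toRat a = toRat b ∧ p = (toCompletion R⁰ a, toCompletion R⁰ b)}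

/-! The remaining facts show that this is a partial action by partial homeomorphisms. -/

/-- The principal constructible subgroup `sR`. -/
def principal (s : R⁰) : Constructible R⁰ R :=
  ⟨(⊤ : AddSubgroup R).map (DistribSMul.toAddMonoidHom R s), .image s .top⟩

theorem mem_principal {s : R⁰} {a : R} : a ∈ (principal s).1 ↔ ∃ t : R, a = s * t := by
  simp only [principal, AddSubgroup.mem_map, AddSubgroup.mem_top, true_and]
  exact ⟨fun ⟨t, h⟩ => ⟨t, h.symm⟩, fun ⟨t, h⟩ => ⟨t, h.symm⟩⟩

theorem principal_mul_le_left (s t : R⁰) : (principal (s * t)).1 ≤ (principal s).1 := by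
  intro a ha
  obtain ⟨c, rfl⟩ := mem_principal.1 ha
  exact mem_principal.2 ⟨t * c, by push_cast; ring⟩

theorem principal_mul_le_right (s t : R⁰) : (principal (s * t)).1 ≤ (principal t).1 := by
  rw [mul_comm]; exact principal_mul_le_left t s

theorem exists_principal_le {C : AddSubgroup R} (hC : IsConstructible R⁰ R C) :
    ∃ s : R⁰, (principal s).1 ≤ C := by
  induction hC with
  | top => exact ⟨1, le_top⟩
  | image t _ ih =>
    obtain ⟨s, hs⟩ := ih
    refine ⟨t * s, fun a ha => ?_⟩
    obtain ⟨c, rfl⟩ := mem_principal.1 ha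
    exact ⟨s * c, hs (mem_principal.2 ⟨c, rfl⟩), (mul_assoc (t : R) s c).symm⟩
  | preimage t _ ih =>
    obtain ⟨s, hs⟩ := ih
    refine ⟨s, fun a ha => ?_⟩
    obtain ⟨c, rfl⟩ := mem_principal.1 ha
    exact hs (mem_principal.2 ⟨t * c, mul_left_comm (t : R) s c⟩)

theorem eq_of_le {x : RingCompletion R} {C D : Constructible R⁰ R} (h : C.1 ≤ D.1) {a : R}
    (hx : x.1 C = (a : R ⧸ C.1)) : x.1 D = (a : R ⧸ D.1) := by
  rw [← x.2 C D h, hx]; rfl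

theorem eq_of_le' {x y : RingCompletion R} {C D : Constructible R⁰ R} (h : C.1 ≤ D.1)
    (hx : x.1 C = y.1 C) : x.1 D = y.1 D := by
  rw [← x.2 C D h, hx, y.2 C D h]

theorem mk_eq_mk {C : AddSubgroup R} {a b : R} :
    (a : R ⧸ C) = (b : R ⧸ C) ↔ b - a ∈ C := by
  rw [QuotientAddGroup.eq, neg_add_eq_sub]

theorem exists_rep (x : RingCompletion R) (C : Constructible R⁰ R) :
    ∃ a : R, x.1 C = (a : R ⧸ C.1) :=
  (QuotientAddGroup.mk_surjective (x.1 C)).imp fun _ h => h.symm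

theorem isOpen_cyl (C : Constructible R⁰ R) (q : R ⧸ C.1) :
    IsOpen {x : RingCompletion R | x.1 C = q} := by
  let _ : ∀ C : Constructible R⁰ R, TopologicalSpace (R ⧸ C.1) := fun _ => ⊥
  have : ∀ C : Constructible R⁰ R, DiscreteTopology (R ⧸ C.1) := fun _ => ⟨rfl⟩
  exact IsOpen.preimage (t := {q}) (f := fun x : RingCompletion R => x.1 C)
    ((continuous_apply C).comp continuous_subtype_val) (isOpen_discrete {q})

theorem exists_cyl_subset {x : RingCompletion R} {U : Set (RingCompletion R)} (hU : U ∈ 𝓝 x) :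
    ∃ s : R⁰, ∀ y : RingCompletion R, y.1 (principal s) = x.1 (principal s) → y ∈ U := by
  let _ : ∀ C : Constructible R⁰ R, TopologicalSpace (R ⧸ C.1) := fun _ => ⊥
  have : ∀ C : Constructible R⁰ R, DiscreteTopology (R ⧸ C.1) := fun _ => ⟨rfl⟩
  obtain ⟨V, hV, hVU⟩ := mem_nhds_induced _ _ _ |>.1 hU
  rw [nhds_pi, Filter.mem_pi] at hV
  obtain ⟨I, hI, t, ht, htV⟩ := hV
  have key : ∃ s : R⁰, ∀ C ∈ I, (principal s).1 ≤ C.1 := by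
    clear htV
    induction I, hI using Set.Finite.induction_on with
    | empty => exact ⟨1, by simp⟩
    | @insert C J _ _ ih =>
      obtain ⟨s, hs⟩ := ih
      obtain ⟨r, hr⟩ := exists_principal_le C.2
      refine ⟨r * s, ?_⟩
      rintro D (rfl | hD)
      · exact (principal_mul_le_left r s).trans hr
      · exact (principal_mul_le_right r s).trans (hs D hD)
  obtain ⟨s, hs⟩ := key
  refine ⟨s, fun y hy => hVU (htV fun C hC => ?_)⟩
  rw [eq_of_le' (hs C hC) hy]
  exact mem_of_mem_nhds (ht C)

theorem completion_ext {x y : RingCompletion R}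
    (h : ∀ s : R⁰, x.1 (principal s) = y.1 (principal s)) : x = y := by
  apply Subtype.ext
  funext C
  obtain ⟨s, hs⟩ := exists_principal_le C.2
  exact eq_of_le' hs (h s)

theorem extends_iff {g : AffineGroup R} {x y : RingCompletion R} :
    Extends g x y ↔ ∀ s : R⁰, ∃ a b : R, g • toRat a = toRat b ∧
      x.1 (principal s) = (a : R ⧸ (principal s).1) ∧
      y.1 (principal s) = (b : R ⧸ (principal s).1) := by
  constructor
  · intro h s
    obtain ⟨⟨x', y'⟩, ⟨hx, hy⟩, a, b, hab, he⟩ := mem_closure_iff.1 h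
      ({z | z.1 (principal s) = x.1 (principal s)} ×ˢ {z | z.1 (principal s) = y.1 (principal s)})
      ((isOpen_cyl _ _).prod (isOpen_cyl _ _))
      (Set.mk_mem_prod (Set.mem_ofPred.2 rfl) (Set.mem_ofPred.2 rfl))
    obtain ⟨rfl, rfl⟩ := Prod.mk.inj he
    exact ⟨a, b, hab, hx.symm, hy.symm⟩
  · intro h
    refine mem_closure_iff_nhds.2 fun U hU => ?_
    obtain ⟨V, hV, W, hW, hVW⟩ := mem_nhds_prod_iff.1 hU
    obtain ⟨s, hs⟩ := exists_cyl_subset hV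
    obtain ⟨t, ht⟩ := exists_cyl_subset hW
    obtain ⟨a, b, hab, hx, hy⟩ := h (s * t)
    exact ⟨(toCompletion R⁰ a, toCompletion R⁰ b),
      hVW ⟨hs _ (eq_of_le (principal_mul_le_left s t) hx).symm,
        ht _ (eq_of_le (principal_mul_le_right s t) hy).symm⟩, a, b, hab, rfl⟩

theorem Extends.one (x : RingCompletion R) : Extends 1 x x :=
  extends_iff.2 fun s =>
    let ⟨a, ha⟩ := exists_rep x (principal s)
    ⟨a, a, one_smul _ _, ha, ha⟩

theorem Extends.inv {g : AffineGroup R} {x y : RingCompletion R} (h : Extends g x y) :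
    Extends g⁻¹ y x :=
  extends_iff.2 fun s =>
    let ⟨a, b, hab, hx, hy⟩ := extends_iff.1 h s
    ⟨b, a, by rw [← hab, inv_smul_smul], hy, hx⟩

variable [IsAddTorsionFree R]

theorem toRat_injective : Function.Injective (toRat : R → RatAlg R) :=
  Algebra.TensorProduct.includeRight_injective (R := ℤ) (A := ℚ) (B := R)
    (RingHom.injective_int (algebraMap ℤ ℚ))

theorem natCast_mem (n : ℕ) (hn : n ≠ 0) : (n : R) ∈ R⁰ := by
  rw [mem_nonZeroDivisors_iff_right]
  intro x hx
  rw [mul_comm, ← nsmul_eq_mul] at hx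
  exact (smul_eq_zero.1 hx).resolve_left hn

theorem exists_denom (q : RatAlg R) : ∃ (n : R⁰) (c : R), q * toRat (n : R) = toRat c := by
  induction q using TensorProduct.induction_on with
  | zero => exact ⟨1, 0, by simp⟩
  | tmul q a =>
    refine ⟨⟨(q.den : R), natCast_mem _ q.den_nz⟩, (q.num : R) * a, ?_⟩
    have h : (q : ℚ) * (q.den : ℚ) = q.num := Rat.mul_den_eq_num q
    have e1 : toRat (q.den : R) = (q.den : ℚ) ⊗ₜ[ℤ] (1 : R) := by
      rw [map_natCast]; exact (Algebra.TensorProduct.natCast_def (A := ℚ) (B := R) q.den)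
    have e2 : toRat (q.num : R) = (q.num : ℚ) ⊗ₜ[ℤ] (1 : R) := by
      rw [map_intCast]; exact (Algebra.TensorProduct.intCast_def (A := ℚ) (B := R) q.num)
    rw [e1, map_mul, e2, Algebra.TensorProduct.tmul_mul_tmul, h, mul_one]
    change _ = (q.num : ℚ) ⊗ₜ[ℤ] (1 : R) * (1 : ℚ) ⊗ₜ[ℤ] a
    rw [Algebra.TensorProduct.tmul_mul_tmul, mul_one, one_mul]
  | add p q hp hq =>
    obtain ⟨n, c, hc⟩ := hp
    obtain ⟨m, d, hd⟩ := hq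
    refine ⟨n * m, c * m + d * n, ?_⟩
    push_cast
    rw [map_add, map_mul, map_mul, map_mul, ← hc, ← hd]
    ring

/-- Every `g` maps cosets of `snR` into cosets of `sR`, for a suitable `n` and all `s`. -/
theorem exists_modulus (g : AffineGroup R) : ∃ n : R⁰, ∀ (s : R⁰) (a a' b : R),
    g • toRat a = toRat b → a' - a ∈ (principal (s * n)).1 →
    ∃ b', g • toRat a' = toRat b' ∧ b' - b ∈ (principal s).1 := by
  obtain ⟨n, c, hc⟩ := exists_denom (g.right : RatAlg R)
  refine ⟨n, fun s a a' b hab h => ?_⟩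
  obtain ⟨t, ht⟩ := mem_principal.1 h
  obtain rfl : a' = a + s * n * t := by rw [← sub_eq_iff_eq_add', ht]; push_cast; ring
  refine ⟨b + s * (c * t), ?_, mem_principal.2 ⟨c * t, by ring⟩⟩
  rw [affine_smul_def] at hab ⊢
  simp only [map_add, map_mul, ← hab, ← hc]
  ring

/-- Congruent arguments have congruent values. -/
theorem exists_modulus' (g : AffineGroup R) : ∃ n : R⁰, ∀ (s : R⁰) (a a' b b' : R),
    g • toRat a = toRat b → g • toRat a' = toRat b' → a' - a ∈ (principal (s * n)).1 →
    b' - b ∈ (principal s).1 := by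
  obtain ⟨n, hn⟩ := exists_modulus g
  refine ⟨n, fun s a a' b b' hab hab' h => ?_⟩
  obtain ⟨d, hd, hdb⟩ := hn s a a' b hab h
  rwa [toRat_injective (hab'.symm.trans hd)]

theorem Extends.mul {g h : AffineGroup R} {x y z : RingCompletion R} (hxy : Extends h x y)
    (hyz : Extends g y z) : Extends (g * h) x z := by
  obtain ⟨n, hn⟩ := exists_modulus g
  refine extends_iff.2 fun s => ?_
  obtain ⟨a, b, hab, hx, hy⟩ := extends_iff.1 hxy (s * n)
  obtain ⟨b', c', hbc, hy', hz⟩ := extends_iff.1 hyz (s * n)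
  obtain ⟨c, hc, hcc⟩ := hn s b' b c' hbc (mk_eq_mk.1 (hy'.symm.trans hy))
  refine ⟨a, c, by rw [mul_smul, hab, hc], eq_of_le (principal_mul_le_left s n) hx, ?_⟩
  rw [eq_of_le (principal_mul_le_left s n) hz]
  exact mk_eq_mk.2 hcc

/-- Uniform continuity of the extended map; for `x = x'` it says that `g.x` is unique. -/
theorem Extends.congr (g : AffineGroup R) : ∃ n : R⁰, ∀ (s : R⁰) (x x' y y' : RingCompletion R),
    Extends g x y → Extends g x' y' → x.1 (principal (s * n)) = x'.1 (principal (s * n)) →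
    y.1 (principal s) = y'.1 (principal s) := by
  obtain ⟨n, hn⟩ := exists_modulus' g
  refine ⟨n, fun s x x' y y' h h' hxx => ?_⟩
  obtain ⟨a, b, hab, hx, hy⟩ := extends_iff.1 h (s * n)
  obtain ⟨a', b', hab', hx', hy'⟩ := extends_iff.1 h' (s * n)
  rw [eq_of_le (principal_mul_le_left s n) hy, eq_of_le (principal_mul_le_left s n) hy']
  exact mk_eq_mk.2 (hn s a a' b b' hab hab' (mk_eq_mk.1 (hx.symm.trans (hxx.trans hx'))))

theorem Extends.unique {g : AffineGroup R} {x y y' : RingCompletion R} (h : Extends g x y)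
    (h' : Extends g x y') : y = y' := by
  obtain ⟨n, hn⟩ := Extends.congr g
  exact completion_ext fun s => hn s x x y y' h h' rfl

theorem exists_extends (g : AffineGroup R) : ∃ n : R⁰, ∀ (x : RingCompletion R) (a b : R),
    g • toRat a = toRat b → x.1 (principal n) = (a : R ⧸ (principal n).1) →
    ∃ y, Extends g x y := by
  obtain ⟨n, hn⟩ := exists_modulus g
  obtain ⟨m, hm⟩ := exists_modulus' g
  refine ⟨n, fun x a b hab hx => ?_⟩
  have key : ∀ s : R⁰, ∃ e f : R, g • toRat e = toRat f ∧
      x.1 (principal (s * m * n)) = (e : R ⧸ (principal (s * m * n)).1) := by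
    intro s
    obtain ⟨e, he⟩ := exists_rep x (principal (s * m * n))
    have h1 := eq_of_le (principal_mul_le_right (s * m) n) he
    obtain ⟨f, hf, -⟩ := hn 1 a e b hab (by rw [one_mul]; exact mk_eq_mk.1 (hx.symm.trans h1))
    exact ⟨e, f, hf, he⟩
  choose e f hef hxe using key
  have hcmp : ∀ s t : R⁰, f (s * t) - f s ∈ (principal s).1 := fun s t => by
    refine hm s _ _ _ _ (hef s) (hef (s * t)) (mk_eq_mk.1 ?_)
    rw [← eq_of_le (principal_mul_le_left (s * m) n) (hxe s), ← eq_of_le ?_ (hxe (s * t))]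
    rw [show s * t * m * n = (s * m) * (t * n) by ac_rfl]
    exact principal_mul_le_left _ _
  choose σ hσ using fun C : Constructible R⁰ R => exists_principal_le C.2
  have hind : ∀ (D : Constructible R⁰ R) (s t : R⁰), (principal s).1 ≤ D.1 →
      (principal t).1 ≤ D.1 → (f s : R ⧸ D.1) = (f t : R ⧸ D.1) := fun D s t hs ht => by
    have h1 : (f s : R ⧸ D.1) = (f (s * t) : R ⧸ D.1) := mk_eq_mk.2 (hs (hcmp s t))
    have h2 : (f t : R ⧸ D.1) = (f (t * s) : R ⧸ D.1) := mk_eq_mk.2 (ht (hcmp t s))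
    rw [h1, h2, mul_comm]
  refine ⟨⟨fun C => (f (σ C) : R ⧸ C.1), fun C D h => ?_⟩, extends_iff.2 fun s => ?_⟩
  · exact hind D (σ C) (σ D) ((hσ C).trans h) (hσ D)
  · refine ⟨e s, f s, hef s, eq_of_le ?_ (hxe s), hind _ _ _ (hσ _) le_rfl⟩
    rw [mul_assoc]
    exact principal_mul_le_left _ _

variable (R) in
/-- The partial action of `ℚR ⋊ (ℚR)ˣ` on the completion of `R` that extends the partial action
on `R` by affine maps. -/
noncomputable def ringPartialAction : PartialAction (AffineGroup R) (RingCompletion R) where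
  dom g := {x | ∃ y, Extends g x y}
  act _ _ hx := hx.choose
  isOpen_dom g := by
    obtain ⟨n, hn⟩ := exists_extends g
    rw [isOpen_iff_mem_nhds]
    rintro x ⟨y, hxy⟩
    obtain ⟨a, b, hab, hx, -⟩ := extends_iff.1 hxy n
    exact Filter.mem_of_superset ((isOpen_cyl (principal n) _).mem_nhds hx)
      fun x' hx' => hn x' a b hab hx'
  continuous_act g := by
    obtain ⟨n, hn⟩ := Extends.congr g
    rw [continuous_iff_continuousAt]
    intro x U hU
    obtain ⟨s, hs⟩ := exists_cyl_subset hU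
    have hV := ((isOpen_cyl (principal (s * n)) (x.1.1 _)).preimage
      (continuous_subtype_val (p := fun x => ∃ y, Extends g x y))).mem_nhds (x := x) rfl
    refine Filter.mem_map.2 (Filter.mem_of_superset hV fun x' hx' => ?_)
    exact hs _ (hn s _ _ _ _ (Exists.choose_spec x'.2) (Exists.choose_spec x.2) hx')
  mem_dom_one x := ⟨x, Extends.one x⟩
  act_one x := Extends.unique (Exists.choose_spec (⟨x, Extends.one x⟩ : ∃ y, Extends 1 x y))
    (Extends.one x)
  mem_dom_inv _ x hx := ⟨x, hx.choose_spec.inv⟩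
  act_inv _ x hx := Extends.unique (Exists.choose_spec (⟨x, hx.choose_spec.inv⟩ : ∃ y, _))
    hx.choose_spec.inv
  mem_dom_mul _ _ _ hx hy := ⟨_, hx.choose_spec.mul hy.choose_spec⟩
  act_mul _ _ _ hx hy := Extends.unique
    (Exists.choose_spec (⟨_, hx.choose_spec.mul hy.choose_spec⟩ : ∃ y, _))
    (hx.choose_spec.mul hy.choose_spec)

variable (R) in
/-- The groupoid `(ℚR ⋊ (ℚR)ˣ) ⋉ R̄` of the multiplication action of the non-zerodivisors of `R`
on `R`, where `R̄` is the completion of `R`. -/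
noncomputable def ringGroupoid : TopGroupoid.{u} := (ringPartialAction R).groupoid

end Rings

end AlgAction

/-! An isomorphism of transformation groupoids is a homeomorphism of unit spaces together with a
locally constant cocycle `c(g, x)` valued in the second affine group. Translations by `a ∈ R₁` are
defined on all of the compact completion, so `c(τ_a, ·)` is periodic on `R₁`; since `R₁` is finitely
generated, one period `n` serves all `a` (`exists_period`). Hence `a ↦ c(τ_{na}, 0)` is a
homomorphism to the affine group.

Evaluating `δ_γ τ_a = τ_{γa} δ_γ` at `0` ties this homomorphism to dilations
(`integralCocycle_dilation_mul`). For `γ = 2` and `a` close to `0`, the linear part `u` of `c(τ_a,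
0)` satisfies `u = u²`, so the values are translations after enlarging `n`
(`exists_additive_cocycle`). For general `γ`, the relation makes the resulting `ℚ`-linear map `f :
ℚR₁ → ℚR₂` carry multiplication by `γ` to multiplication by some `β`. The map `f` is injective
because an arrow with trivial cocycle fixes its source (`exists_linearMap`).

By symmetry the dimensions agree, so `f` is bijective. Every element of `ℚR₁` is a unit plus a
rational scalar, so `f` intertwines all multiplications, and `y ↦ f(y) f(1)⁻¹` is an algebra
isomorphism. -/

namespace AlgAction

/-! ### The cocycle of a groupoid isomorphism -/

section Isomorphisms

/-- The inverse of an isomorphism of topological groupoids. -/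
def TopGroupoid.Iso.symm {G : TopGroupoid.{u}} {H : TopGroupoid.{v}} (e : TopGroupoid.Iso G H) :
    TopGroupoid.Iso H G where
  obj := e.obj.symm
  arr := e.arr.symm
  src_arr a := by
    rw [Homeomorph.eq_symm_apply, ← e.src_arr, Homeomorph.apply_symm_apply]
  tgt_arr a := by
    rw [Homeomorph.eq_symm_apply, ← e.tgt_arr, Homeomorph.apply_symm_apply]
  arr_mul a b h := by
    rw [Homeomorph.symm_apply_eq, e.arr_mul]
    congr 1 <;> rw [Homeomorph.apply_symm_apply]

variable {G : Type u} [Group G] {X : Type u} [TopologicalSpace X] {θ : PartialAction G X}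
  {H : Type v} [Group H] {Y : Type v} [TopologicalSpace Y] {η : PartialAction H Y}

namespace PartialAction

/-- The group-valued cocycle of an isomorphism of transformation groupoids. -/
def cocycle (e : TopGroupoid.Iso θ.groupoid η.groupoid) (g : G) (x : X) (hx : x ∈ θ.dom g) : H :=
  (show η.Arrow from e.arr (show θ.Arrow from ⟨(g, x), hx⟩)).1.1

variable (e : TopGroupoid.Iso θ.groupoid η.groupoid)

/-- The homeomorphism of unit spaces of an isomorphism of transformation groupoids. -/
def unitMap (x : X) : Y := e.obj x

theorem unitMap_injective : Function.Injective (unitMap e) := e.obj.injective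

theorem snd_arr (g : G) (x : X) (hx : x ∈ θ.dom g) :
    (show η.Arrow from e.arr (show θ.Arrow from ⟨(g, x), hx⟩)).1.2 = unitMap e x :=
  e.src_arr (show θ.Arrow from ⟨(g, x), hx⟩)

theorem unitMap_mem_dom (g : G) (x : X) (hx : x ∈ θ.dom g) :
    unitMap e x ∈ η.dom (cocycle e g x hx) := by
  rw [← snd_arr e g x hx]
  exact (show η.Arrow from e.arr (show θ.Arrow from ⟨(g, x), hx⟩)).2

theorem act_cocycle (g : G) (x : X) (hx : x ∈ θ.dom g) :
    η.act (cocycle e g x hx) (unitMap e x) (unitMap_mem_dom e g x hx) =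
      unitMap e (θ.act g x hx) :=
  (η.act_congr rfl (snd_arr e g x hx).symm _).trans
    (e.tgt_arr (show θ.Arrow from ⟨(g, x), hx⟩))

theorem cocycle_mul (g h : G) (x : X) (hx : x ∈ θ.dom h) (hy : θ.act h x hx ∈ θ.dom g) :
    cocycle e (g * h) x (θ.mem_dom_mul g h x hx hy) =
      cocycle e g (θ.act h x hx) hy * cocycle e h x hx :=
  congrArg (fun a : η.Arrow => a.1.1)
    (e.arr_mul (show θ.Arrow from ⟨(g, θ.act h x hx), hy⟩) (show θ.Arrow from ⟨(h, x), hx⟩) rfl)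

/-- The group component of an arrow depends continuously on the arrow and takes values in a discrete
space. -/
theorem cocycle_locally_constant (g : G) (x : X) (hx : x ∈ θ.dom g) :
    ∀ᶠ x' in 𝓝 x, ∀ hx' : x' ∈ θ.dom g, cocycle e g x' hx' = cocycle e g x hx := by
  let _ : TopologicalSpace G := ⊥
  let _ : TopologicalSpace H := ⊥
  have : DiscreteTopology H := ⟨rfl⟩
  have h1 : Continuous fun x' : θ.dom g => (show θ.Arrow from ⟨(g, x'.1), x'.2⟩) :=
    θ.continuous_arrowMk _ continuous_const continuous_subtype_val
  have h2 : Continuous fun x' : θ.dom g => cocycle e g x'.1 x'.2 :=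
    η.continuous_fst_arrow.comp (e.arr.continuous.comp h1)
  have h3 : ∀ᶠ x' : θ.dom g in 𝓝 ⟨x, hx⟩, cocycle e g x'.1 x'.2 = cocycle e g x hx :=
    h2.continuousAt.eventually (p := fun k => k = cocycle e g x hx)
      ((isOpen_discrete {cocycle e g x hx}).mem_nhds rfl)
  rw [nhds_subtype_eq_comap, Filter.eventually_comap] at h3
  exact h3.mono fun x' h hx' => h ⟨x', hx'⟩ rfl

end PartialAction

end Isomorphisms

/-! ### Integer moduli and compactness of the completion -/

section FiniteRank

variable {R : Type u} [CommRing R]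

theorem exists_nsmul_eq_toRat (q : RatAlg R) : ∃ n : ℕ, n ≠ 0 ∧ ∃ c : R, n • q = toRat c := by
  induction q using TensorProduct.induction_on with
  | zero => exact ⟨1, one_ne_zero, 0, by simp⟩
  | tmul q a =>
    refine ⟨q.den, q.den_nz, q.num • a, ?_⟩
    have h : q.den • q = (q.num : ℚ) := by
      rw [nsmul_eq_mul, mul_comm, Rat.mul_den_eq_num]
    change _ = (1 : ℚ) ⊗ₜ[ℤ] (q.num • a)
    rw [← TensorProduct.smul_tmul, TensorProduct.smul_tmul', h, zsmul_one]
  | add p q hp hq =>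
    obtain ⟨n, hn, c, hc⟩ := hp
    obtain ⟨m, hm, d, hd⟩ := hq
    refine ⟨n * m, mul_ne_zero hn hm, m • c + n • d, ?_⟩
    rw [map_add, map_nsmul, map_nsmul, ← hc, ← hd, smul_add, mul_smul, mul_smul, smul_comm n m p]

variable [IsAddTorsionFree R] [Module.Finite ℤ R]

/-- A non-zerodivisor stays one in the finite-dimensional algebra `ℚR`, hence is a unit there; `n`
clears the denominator of its inverse. Thus the subgroups `nR` are cofinal among the constructible
ones. -/
theorem exists_natCast_dvd (s : R⁰) : ∃ n : ℕ, n ≠ 0 ∧ (s : R) ∣ n := by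
  have hs : toRat (s : R) ∈ (RatAlg R)⁰ := by
    rw [mem_nonZeroDivisors_iff_right]
    intro x hx
    obtain ⟨n, hn, c, hc⟩ := exists_nsmul_eq_toRat x
    have h1 : c * (s : R) = 0 := toRat_injective (by
      rw [map_mul, ← hc, smul_mul_assoc, hx, smul_zero, map_zero])
    rw [(mem_nonZeroDivisors_iff_right.1 s.2) c h1, map_zero] at hc
    have : n • x = n • (0 : RatAlg R) := by rw [hc, smul_zero]
    rw [← Nat.cast_smul_eq_nsmul ℚ, ← Nat.cast_smul_eq_nsmul ℚ n (0 : RatAlg R)] at this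
    exact smul_right_injective _ (Nat.cast_ne_zero.2 hn) this
  have : IsArtinianRing (RatAlg R) := IsArtinianRing.of_finite ℚ _
  obtain ⟨q, hq⟩ := (IsArtinianRing.isUnit_of_mem_nonZeroDivisors hs).exists_right_inv
  obtain ⟨n, hn, c, hc⟩ := exists_nsmul_eq_toRat q
  refine ⟨n, hn, c, toRat_injective ?_⟩
  rw [map_mul, ← hc, mul_smul_comm, hq, map_natCast, nsmul_one]

theorem finite_quotient_constructible {C : AddSubgroup R} (hC : IsConstructible R⁰ R C) :
    Finite (R ⧸ C) := by
  obtain ⟨s, hs⟩ := exists_principal_le hC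
  obtain ⟨n, hn, c, hc⟩ := exists_natCast_dvd s
  have : AddGroup.FG R := Module.Finite.iff_addGroup_fg.1 inferInstance
  refine AddCommGroup.finite_of_fg_isAddTorsion _ fun x => ?_
  obtain ⟨a, rfl⟩ := QuotientAddGroup.mk_surjective x
  rw [isOfFinAddOrder_iff_nsmul_eq_zero]
  refine ⟨n, Nat.pos_of_ne_zero hn, ?_⟩
  change ((n • a : R) : R ⧸ C) = 0
  rw [QuotientAddGroup.eq_zero_iff]
  exact hs (mem_principal.2 ⟨c * a, by rw [nsmul_eq_mul, hc, mul_assoc]⟩)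

instance : CompactSpace (RingCompletion R) := by
  let _ : ∀ C : Constructible R⁰ R, TopologicalSpace (R ⧸ C.1) := fun _ => ⊥
  have : ∀ C : Constructible R⁰ R, DiscreteTopology (R ⧸ C.1) := fun _ => ⟨rfl⟩
  have : ∀ C : Constructible R⁰ R, Finite (R ⧸ C.1) := fun C => finite_quotient_constructible C.2
  have h : IsClosed {x : ∀ C : Constructible R⁰ R, R ⧸ C.1 |
      ∀ (C D : Constructible R⁰ R) (h : C.1 ≤ D.1),
        AddSubgroup.quotientMapOfLE h (x C) = x D} := by
    simp only [Set.ofPred_forall]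
    refine isClosed_iInter fun C => isClosed_iInter fun D => isClosed_iInter fun h => ?_
    exact isClosed_eq (continuous_of_discreteTopology.comp (continuous_apply C))
      (continuous_apply D)
  exact isCompact_iff_compactSpace.1 h.isCompact

/-- A family of neighbourhoods, one of each point, contains the classes modulo some `n ≠ 0`. -/
theorem exists_modulus_of_forall_eventually {p : RingCompletion R → RingCompletion R → Prop}
    (h : ∀ x, ∀ᶠ y in 𝓝 x, p x y) : ∃ n : ℕ, n ≠ 0 ∧ ∀ a : R, ∃ x, ∀ t : R,
      p x (toCompletion R⁰ (a + n * t)) := by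
  choose s hs using fun x => exists_cyl_subset (h x)
  obtain ⟨I, hI⟩ := CompactSpace.elim_nhds_subcover
    (fun x => {y : RingCompletion R | y.1 (principal (s x)) = x.1 (principal (s x))})
    (fun x => (isOpen_cyl _ _).mem_nhds rfl)
  choose m hm hmd using fun x => exists_natCast_dvd (s x)
  -- The product over a finite subcover is divisible by the modulus of every cylinder in it.
  refine ⟨∏ x ∈ I, m x, Finset.prod_ne_zero_iff.2 fun x _ => hm x, fun a => ?_⟩
  have ha : toCompletion R⁰ a ∈ (⊤ : Set (RingCompletion R)) := trivial
  rw [← hI] at ha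
  simp only [Set.mem_iUnion] at ha
  obtain ⟨x, hx, hax⟩ := ha
  refine ⟨x, fun t => hs x _ ?_⟩
  change (toCompletion R⁰ a).1 (principal (s x)) = x.1 (principal (s x)) at hax
  rw [← hax]
  refine mk_eq_mk.2 ?_
  obtain ⟨c, hc⟩ := (hmd x).trans
    (Nat.cast_dvd_cast (α := R) (Finset.dvd_prod_of_mem m hx))
  exact mem_principal.2 ⟨-(c * t), by rw [hc]; ring⟩

theorem exists_modulus_of_eventually {p : RingCompletion R → Prop} {a : R}
    (h : ∀ᶠ y in 𝓝 (toCompletion R⁰ a), p y) : ∃ n : ℕ, n ≠ 0 ∧ ∀ t : R,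
      p (toCompletion R⁰ (a + n * t)) := by
  obtain ⟨s, hs⟩ := exists_cyl_subset h
  obtain ⟨n, hn, c, hc⟩ := exists_natCast_dvd s
  refine ⟨n, hn, fun t => hs _ (mk_eq_mk.2 (mem_principal.2 ⟨-(c * t), by rw [hc]; ring⟩))⟩

/-- If `a` and `b` have the same image, each coordinate `k` of `a - b` in a `ℤ`-basis is divisible
by `|k| + 1`, hence zero. -/
theorem toCompletion_injective : Function.Injective (toCompletion R⁰ : R → RingCompletion R) := by
  intro a b hab
  have : Module.Free ℤ R := inferInstance
  let B := Module.Free.chooseBasis ℤ R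
  rw [← sub_eq_zero]
  refine B.ext_elem fun i => ?_
  rw [map_zero, Finsupp.zero_apply]
  set k := B.repr (a - b) i with hk
  have hn : k.natAbs + 1 ≠ 0 := Nat.succ_ne_zero _
  have h := congrArg (fun x : RingCompletion R =>
    x.1 (principal ⟨((k.natAbs + 1 : ℕ) : R), natCast_mem _ hn⟩)) hab.symm
  obtain ⟨t, ht⟩ := mem_principal.1 (mk_eq_mk.1 h)
  simp only [← nsmul_eq_mul] at ht
  rw [ht, map_nsmul, Finsupp.smul_apply, nsmul_eq_mul] at hk
  refine Int.eq_zero_of_abs_lt_dvd (m := (k.natAbs + 1 : ℕ)) ⟨_, hk⟩ ?_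
  rw [Int.abs_eq_natAbs]
  push_cast
  omega

end FiniteRank

end AlgAction

namespace AlgAction

/-! ### Translations and dilations -/

section Affine

variable {R : Type u} [CommRing R]

/-- The translation `x ↦ z + x`. -/
def translation (z : RatAlg R) : AffineGroup R := SemidirectProduct.inl (Multiplicative.ofAdd z)

/-- The dilation `x ↦ γ x`. -/
def dilation (γ : (RatAlg R)ˣ) : AffineGroup R := SemidirectProduct.inr γ

theorem affine_ext {g h : AffineGroup R} (h1 : g.left.toAdd = h.left.toAdd)
    (h2 : g.right = h.right) : g = h :=
  SemidirectProduct.ext h1 h2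

theorem left_mul (g h : AffineGroup R) :
    (g * h).left.toAdd = g.left.toAdd + (g.right : RatAlg R) * h.left.toAdd := rfl

theorem right_mul (g h : AffineGroup R) : (g * h).right = g.right * h.right := rfl

theorem translation_smul (z x : RatAlg R) : translation z • x = z + x := by
  rw [affine_smul_def]
  change z + ((1 : (RatAlg R)ˣ) : RatAlg R) * x = z + x
  rw [Units.val_one, one_mul]

theorem dilation_smul (γ : (RatAlg R)ˣ) (x : RatAlg R) : dilation γ • x = (γ : RatAlg R) * x := by
  rw [affine_smul_def]
  change 0 + (γ : RatAlg R) * x = (γ : RatAlg R) * x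
  rw [zero_add]

theorem translation_add (z w : RatAlg R) : translation (z + w) = translation z * translation w := by
  rw [translation, ofAdd_add, map_mul]; rfl

theorem dilation_mul_translation (γ : (RatAlg R)ˣ) (z : RatAlg R) :
    dilation γ * translation z = translation ((γ : RatAlg R) * z) * dilation γ := by
  refine affine_ext ?_ ?_
  · rw [left_mul, left_mul]
    change 0 + (γ : RatAlg R) * z = γ * z + _ * 0
    rw [mul_zero, add_zero, zero_add]
  · change γ * 1 = 1 * γ
    rw [mul_one, one_mul]

theorem translation_smul_toRat (a b : R) :
    translation (toRat a) • toRat b = toRat (a + b) := by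
  rw [translation_smul, map_add]

theorem extends_toCompletion {g : AffineGroup R} {a b : R} (h : g • toRat a = toRat b) :
    Extends g (toCompletion R⁰ a) (toCompletion R⁰ b) :=
  subset_closure ⟨a, b, h, rfl⟩

variable [IsAddTorsionFree R]

theorem toCompletion_mem_dom {g : AffineGroup R} {a b : R} (h : g • toRat a = toRat b) :
    toCompletion R⁰ a ∈ (ringPartialAction R).dom g :=
  ⟨_, extends_toCompletion h⟩

theorem act_toCompletion {g : AffineGroup R} {a b : R} (h : g • toRat a = toRat b)
    (ha : toCompletion R⁰ a ∈ (ringPartialAction R).dom g) :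
    (ringPartialAction R).act g (toCompletion R⁰ a) ha = toCompletion R⁰ b :=
  Extends.unique (Exists.choose_spec ha) (extends_toCompletion h)

theorem mem_dom_translation (a : R) (x : RingCompletion R) :
    x ∈ (ringPartialAction R).dom (translation (toRat a)) := by
  obtain ⟨n, hn⟩ := exists_extends (translation (toRat a))
  obtain ⟨b, hb⟩ := exists_rep x (principal n)
  exact hn x b _ (translation_smul_toRat a b) hb

end Affine

/-! ### The cocycle at integral points -/

section IntegralCocycle

variable {R₁ : Type u} {R₂ : Type v} [CommRing R₁] [CommRing R₂]
  [IsAddTorsionFree R₁] [IsAddTorsionFree R₂]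
  (e : TopGroupoid.Iso (ringGroupoid R₁) (ringGroupoid R₂))

open Classical in
/-- The cocycle of an isomorphism of groupoids at the points of `R₁` in its completion. -/
noncomputable def integralCocycle (g : AffineGroup R₁) (a : R₁) : AffineGroup R₂ :=
  if h : toCompletion R₁⁰ a ∈ (ringPartialAction R₁).dom g then
    PartialAction.cocycle e g (toCompletion R₁⁰ a) h else 1

theorem integralCocycle_eq {g : AffineGroup R₁} {a : R₁}
    (h : toCompletion R₁⁰ a ∈ (ringPartialAction R₁).dom g) :
    integralCocycle e g a = PartialAction.cocycle e g (toCompletion R₁⁰ a) h :=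
  dif_pos h

theorem integralCocycle_mul {g h : AffineGroup R₁} {a b c : R₁} (hab : h • toRat a = toRat b)
    (hbc : g • toRat b = toRat c) :
    integralCocycle e (g * h) a = integralCocycle e g b * integralCocycle e h a := by
  have hac : (g * h) • toRat a = toRat c := by rw [mul_smul, hab, hbc]
  have hx := toCompletion_mem_dom hab
  have hy := toCompletion_mem_dom hbc
  rw [integralCocycle_eq e (toCompletion_mem_dom hac), integralCocycle_eq e hx,
    integralCocycle_eq e hy]
  have hxy := act_toCompletion hab hx
  have key := PartialAction.cocycle_mul e g h _ hx (by rw [hxy]; exact hy)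
  rw [key]
  congr 1
  simp only [hxy]

/-- An arrow sent to a unit has equal source and range, since the map of unit spaces is injective.
This is the source of injectivity of the linear map. -/
theorem eq_of_integralCocycle_eq_one {g : AffineGroup R₁} {a b : R₁} [Module.Finite ℤ R₁]
    (hab : g • toRat a = toRat b) (h : integralCocycle e g a = 1) : a = b := by
  have hx := toCompletion_mem_dom hab
  rw [integralCocycle_eq e hx] at h
  have h1 := PartialAction.act_cocycle e g _ hx
  rw [act_toCompletion hab hx, PartialAction.act_congr _ h rfl, PartialAction.act_one] at h1
  exact toCompletion_injective (PartialAction.unitMap_injective e h1)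

theorem integralCocycle_translation_add (a b c : R₁) :
    integralCocycle e (translation (toRat (a + b))) c =
      integralCocycle e (translation (toRat a)) (b + c) *
        integralCocycle e (translation (toRat b)) c := by
  rw [map_add, translation_add]
  exact integralCocycle_mul e (translation_smul_toRat b c) (translation_smul_toRat a (b + c))

theorem integralCocycle_translation_zero (c : R₁) :
    integralCocycle e (translation (toRat 0)) c = 1 := by
  have h := integralCocycle_translation_add e 0 0 c
  rwa [add_zero, zero_add, right_eq_mul] at h

/-- Expands the cocycle at `0` along both sides of `δ_γ τ_a = τ_{γa} δ_γ`. -/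
theorem integralCocycle_dilation_mul (γ : (RatAlg R₁)ˣ) {a b : R₁}
    (hab : (γ : RatAlg R₁) * toRat a = toRat b) :
    integralCocycle e (dilation γ) a * integralCocycle e (translation (toRat a)) 0 =
      integralCocycle e (translation (toRat b)) 0 * integralCocycle e (dilation γ) 0 := by
  have h0 : dilation γ • toRat (0 : R₁) = toRat 0 := by
    rw [dilation_smul, map_zero, mul_zero]
  have h1 : dilation γ • toRat a = toRat b := by rw [dilation_smul, hab]
  have h2 : translation (toRat a) • toRat 0 = toRat a := by
    rw [translation_smul_toRat, add_zero]
  have h3 : translation (toRat b) • toRat 0 = toRat b := by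
    rw [translation_smul_toRat, add_zero]
  rw [← integralCocycle_mul e h2 h1, ← integralCocycle_mul e h0 h3, dilation_mul_translation, hab]

variable [Module.Finite ℤ R₁]

theorem integralCocycle_locally_constant {g : AffineGroup R₁} {a b : R₁}
    (hab : g • toRat a = toRat b) :
    ∃ n : ℕ, n ≠ 0 ∧ ∀ t, integralCocycle e g (a + n * t) = integralCocycle e g a := by
  have hx := toCompletion_mem_dom hab
  obtain ⟨n, hn, h⟩ := exists_modulus_of_eventually
    ((PartialAction.cocycle_locally_constant e g _ hx).and
      (((ringPartialAction R₁).isOpen_dom g).mem_nhds hx))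
  refine ⟨n, hn, fun t => ?_⟩
  rw [integralCocycle_eq e hx, integralCocycle_eq e (h t).2]
  exact (h t).1 _

/-- Translations have full domain, so compactness turns local constancy into a modulus that is
uniform in `b`. -/
theorem integralCocycle_translation_periodic (a : R₁) : ∃ n : ℕ, n ≠ 0 ∧ ∀ b t,
    integralCocycle e (translation (toRat a)) (b + n * t) =
      integralCocycle e (translation (toRat a)) b := by
  obtain ⟨n, hn, h⟩ := exists_modulus_of_forall_eventually fun x =>
    PartialAction.cocycle_locally_constant e (translation (toRat a)) x (mem_dom_translation a x)
  refine ⟨n, hn, fun b t => ?_⟩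
  obtain ⟨x, hx⟩ := h b
  rw [integralCocycle_eq e (mem_dom_translation a _), integralCocycle_eq e (mem_dom_translation a _),
    hx t]
  have := hx 0
  simp only [mul_zero, add_zero] at this
  rw [this (mem_dom_translation a _)]

/-- The cocycle of all translations is periodic with a common period. -/
theorem exists_period : ∃ n : ℕ, n ≠ 0 ∧ ∀ a b t,
    integralCocycle e (translation (toRat a)) (b + n * t) =
      integralCocycle e (translation (toRat a)) b := by
  obtain ⟨S, hS⟩ : (⊤ : Submodule ℤ R₁).FG := Module.Finite.fg_top
  choose m hm hmp using integralCocycle_translation_periodic e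
  -- A period valid at every base point `b` passes to sums and negatives of translations, so a
  -- common multiple over generators suffices.
  refine ⟨∏ x ∈ S, m x, Finset.prod_ne_zero_iff.2 fun x _ => hm x, fun a => ?_⟩
  have ha : a ∈ Submodule.span ℤ (S : Set R₁) := hS ▸ Submodule.mem_top
  have hneg : ∀ a b, integralCocycle e (translation (toRat (-a))) b =
      (integralCocycle e (translation (toRat a)) (-a + b))⁻¹ := fun a b => by
    rw [eq_inv_iff_mul_eq_one]
    have h := integralCocycle_translation_add e (-a) a (-a + b)
    rwa [neg_add_cancel, integralCocycle_translation_zero, add_neg_cancel_left, eq_comm] at h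
  rw [← Submodule.mem_toAddSubgroup, Submodule.span_int_eq_addSubgroupClosure] at ha
  induction ha using AddSubgroup.closure_induction with
  | mem x hx =>
    intro b t
    obtain ⟨k, hk⟩ := Finset.dvd_prod_of_mem m hx
    rw [hk, Nat.cast_mul, mul_assoc, hmp]
  | zero => intro b t; rw [integralCocycle_translation_zero, integralCocycle_translation_zero]
  | add x y _ _ hx hy =>
    intro b t
    rw [integralCocycle_translation_add, integralCocycle_translation_add, hy, ← add_assoc, hx]
  | neg x _ hx => intro b t; rw [hneg, hneg, ← add_assoc, hx]

/-- On a subgroup of finite index, the cocycle at `0` is an additive map into translations. -/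
theorem exists_additive_cocycle : ∃ (n : ℕ) (f : R₁ →+ RatAlg R₂), n ≠ 0 ∧ ∀ a,
    integralCocycle e (translation (toRat (n * a))) 0 = translation (f a) := by
  obtain ⟨n, hn, hper⟩ := exists_period e
  -- The cocycle identity moves the base point from `0` to `n * b`, which periodicity moves back.
  have hadd : ∀ a b : R₁, integralCocycle e (translation (toRat (n * a + n * b))) 0 =
      integralCocycle e (translation (toRat (n * a))) 0 *
        integralCocycle e (translation (toRat (n * b))) 0 := fun a b => by
    rw [integralCocycle_translation_add, add_comm, hper]
  have hu : IsUnit (2 : RatAlg R₁) := by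
    have := (IsUnit.mk0 (2 : ℚ) two_ne_zero).map (algebraMap ℚ (RatAlg R₁))
    rwa [map_ofNat] at this
  obtain ⟨γ, hγ⟩ := hu
  obtain ⟨m, hm, hmc⟩ := integralCocycle_locally_constant e
    (show dilation γ • toRat (0 : R₁) = toRat 0 by rw [dilation_smul, map_zero, mul_zero])
  simp only [zero_add] at hmc
  have hright : ∀ a : R₁,
      (integralCocycle e (translation (toRat ((n * m : ℕ) * a))) 0).right = 1 := fun a => by
    have ha : ((n * m : ℕ) : R₁) * a = n * (m * a) := by push_cast; ring
    -- The factor `m` lets the cocycle of the dilation by `2` be taken at `0`, and the factor `n`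
    -- lets `hadd` split the doubled translation. Linear parts commute, so what remains is `u = u *
    -- u`.
    have h := integralCocycle_dilation_mul e γ (a := m * (n * a)) (b := n * (m * a) + n * (m * a))
      (by rw [hγ, mul_left_comm, map_add, two_mul])
    rw [hadd, hmc, mul_left_comm (m : R₁)] at h
    have h' := congrArg SemidirectProduct.right h
    simp only [right_mul] at h'
    rw [mul_comm (integralCocycle e (dilation γ) 0).right] at h'
    rw [ha]
    exact right_eq_mul.1 (mul_right_cancel h')
  have htr : ∀ a : R₁, integralCocycle e (translation (toRat ((n * m : ℕ) * a))) 0 =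
      translation (integralCocycle e (translation (toRat ((n * m : ℕ) * a))) 0).left.toAdd :=
    fun a => affine_ext rfl (hright a)
  refine ⟨n * m, AddMonoidHom.mk' (fun a =>
    (integralCocycle e (translation (toRat ((n * m : ℕ) * a))) 0).left.toAdd) fun a b => ?_,
    mul_ne_zero hn hm, htr⟩
  have hab : ((n * m : ℕ) : R₁) * (a + b) = n * (m * a) + n * (m * b) := by push_cast; ring
  have ha : ∀ a : R₁, n * (m * a) = ((n * m : ℕ) : R₁) * a := fun a => by push_cast; ring
  rw [hab, hadd, ha, ha, left_mul, hright, Units.val_one, one_mul]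

end IntegralCocycle

/-! ### The induced linear map -/

section Linear

variable {R₁ : Type u} {R₂ : Type v} [CommRing R₁] [CommRing R₂]

theorem ratLinearMap_ext {M : Type*} [AddCommGroup M] [Module ℚ M] {f g : RatAlg R₁ →ₗ[ℚ] M}
    {n : ℕ} (hn : n ≠ 0) (h : ∀ a : R₁, f (toRat (n * a)) = g (toRat (n * a))) : f = g := by
  refine TensorProduct.AlgebraTensorModule.curry_injective ?_
  refine LinearMap.ext_ring (LinearMap.ext fun a => ?_)
  change f (toRat a) = g (toRat a)
  have h1 := h a
  rw [← nsmul_eq_mul, map_nsmul, map_nsmul, map_nsmul, ← Nat.cast_smul_eq_nsmul ℚ,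
    ← Nat.cast_smul_eq_nsmul ℚ] at h1
  exact smul_right_injective _ (Nat.cast_ne_zero.2 hn) h1

variable [IsAddTorsionFree R₁] [IsAddTorsionFree R₂] [Module.Finite ℤ R₁]

/-- An isomorphism of groupoids gives an injective linear map that intertwines multiplication by
units. -/
theorem exists_linearMap (e : TopGroupoid.Iso (ringGroupoid R₁) (ringGroupoid R₂)) :
    ∃ f : RatAlg R₁ →ₗ[ℚ] RatAlg R₂, Function.Injective f ∧
      ∀ γ : (RatAlg R₁)ˣ, ∃ β : RatAlg R₂, ∀ x, f (γ * x) = β * f x := by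
  obtain ⟨n, f, hn, hf⟩ := exists_additive_cocycle e
  let F : RatAlg R₁ →ₗ[ℚ] RatAlg R₂ := LinearMap.liftBaseChange ℚ f.toIntLinearMap
  have hF : ∀ a, F (toRat a) = f a := fun a => by
    change F ((1 : ℚ) ⊗ₜ[ℤ] a) = f a
    rw [LinearMap.liftBaseChange_tmul, one_smul]; rfl
  refine ⟨F, (injective_iff_map_eq_zero F).2 fun x hx => ?_, fun γ => ?_⟩
  -- Some nonzero multiple of a kernel element is integral, say `c`; then translation by `n * c` has
  -- trivial cocycle at `0`, so it fixes `0`.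
  · obtain ⟨k, hk, c, hc⟩ := exists_nsmul_eq_toRat x
    have hfc : f c = 0 := by rw [← hF, ← hc, map_nsmul, hx, smul_zero]
    have h0 := eq_of_integralCocycle_eq_one e (translation_smul_toRat (n * c) 0)
      ((hf c).trans (by rw [hfc]; rfl))
    rw [add_zero, ← nsmul_eq_mul] at h0
    rw [(smul_eq_zero.1 h0.symm).resolve_left hn, map_zero] at hc
    rw [← Nat.cast_smul_eq_nsmul ℚ] at hc
    exact (smul_eq_zero.1 hc).resolve_left (Nat.cast_ne_zero.2 hk)
  · obtain ⟨m, hm, hmc⟩ := integralCocycle_locally_constant e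
      (show dilation γ • toRat (0 : R₁) = toRat 0 by rw [dilation_smul, map_zero, mul_zero])
    simp only [zero_add] at hmc
    obtain ⟨k, hk, d, hd⟩ := exists_nsmul_eq_toRat (γ : RatAlg R₁)
    -- `β` is the linear part of the cocycle of the dilation at `0`. It suffices to compare on `(m *
    -- k) R₁`: `k` clears the denominator of `γ`, and `m` keeps the cocycle of the dilation
    -- constant.
    refine ⟨((integralCocycle e (dilation γ) 0).right : RatAlg R₂), fun x => ?_⟩
    refine LinearMap.congr_fun (f := F ∘ₗ LinearMap.mulLeft ℚ (γ : RatAlg R₁))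
      (g := LinearMap.mulLeft ℚ _ ∘ₗ F)
      (ratLinearMap_ext (mul_ne_zero hm hk) fun a => ?_) x
    have hγ : ∀ a : R₁, (γ : RatAlg R₁) * toRat (((m * k : ℕ) : R₁) * a) = toRat (d * (m * a)) :=
      fun a => by
        rw [map_mul, map_mul, map_mul, ← hd, map_natCast, map_natCast, nsmul_eq_mul]
        push_cast
        ring
    have h := integralCocycle_dilation_mul e γ (a := n * ((m * k : ℕ) * a)) (b := n * (d * (m * a)))
      (by rw [mul_left_comm, hγ]; congr 1; ring)
    rw [hf, hf, show (n : R₁) * ((m * k : ℕ) * a) = m * (n * (k * a)) by push_cast; ring, hmc] at h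
    -- With `z` the translation part of the dilation's cocycle, this reads `z + β f(x) = f(γx) + z`.
    have h' := congrArg (fun g : AffineGroup R₂ => g.left.toAdd) h
    simp only [left_mul] at h'
    change _ + _ * f _ = f _ + ((1 : (RatAlg R₂)ˣ) : RatAlg R₂) * _ at h'
    rw [Units.val_one, one_mul, add_comm, add_right_cancel_iff] at h'
    simp only [LinearMap.comp_apply, LinearMap.mulLeft_apply, hF]
    rw [h', hγ, hF]

end Linear

/-! ### From intertwining maps to algebra isomorphisms -/

section Algebras

variable {A B : Type*} [CommRing A] [Algebra ℚ A] [Module.Finite ℚ A] [CommRing B] [Algebra ℚ B]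

/-- Multiplication by `x` has finitely many rational eigenvalues. For any other `q`, `x - q` is a
non-zerodivisor, hence a unit in an Artinian ring. -/
theorem exists_isUnit_sub_algebraMap (x : A) : ∃ q : ℚ, IsUnit (x - algebraMap ℚ A q) := by
  have hfin : Set.Finite (Module.End.HasEigenvalue (LinearMap.mulLeft ℚ x)) :=
    Module.End.finite_hasEigenvalue _
  obtain ⟨q, hq⟩ := hfin.exists_notMem
  have : IsArtinianRing A := IsArtinianRing.of_finite ℚ A
  refine ⟨q, IsArtinianRing.isUnit_of_mem_nonZeroDivisors ?_⟩
  rw [mem_nonZeroDivisors_iff_right]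
  intro y hy
  by_contra hne
  refine hq (Module.End.hasEigenvalue_of_hasEigenvector (x := y)
    ⟨Module.End.mem_eigenspace_iff.2 ?_, hne⟩)
  rw [LinearMap.mulLeft_apply, Algebra.smul_def, ← sub_eq_zero, ← sub_mul, mul_comm, hy]

/-- A bijective linear map that intertwines multiplication by units yields an isomorphism of
algebras. -/
theorem nonempty_algEquiv_of_intertwining (f : A →ₗ[ℚ] B) (hf : Function.Bijective f)
    (h : ∀ γ : Aˣ, ∃ β : B, ∀ x, f (γ * x) = β * f x) : Nonempty (A ≃ₐ[ℚ] B) := by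
  -- Intertwining extends from units to all elements because scalars already commute with `f`.
  have h' : ∀ y : A, ∃ β : B, ∀ x, f (y * x) = β * f x := fun y => by
    obtain ⟨q, hq⟩ := exists_isUnit_sub_algebraMap y
    obtain ⟨β, hβ⟩ := h hq.unit
    refine ⟨β + algebraMap ℚ B q, fun x => ?_⟩
    have := hβ x
    rw [IsUnit.unit_spec, sub_mul, map_sub, ← Algebra.smul_def, map_smul, Algebra.smul_def,
      sub_eq_iff_eq_add] at this
    rw [this, add_mul]
  choose ψ hψ using h'
  -- If `f y = 1`, then `ψ y * f 1 = 1`. Invertibility of `f 1` forces `ψ y = f y * (f 1)⁻¹`, so the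
  -- chosen `ψ` is linear and multiplicative.
  have hu : IsUnit (f 1) := by
    obtain ⟨y, hy⟩ := hf.2 1
    refine IsUnit.of_mul_eq_one_right (ψ y) ?_
    rw [← hψ, mul_one, hy]
  have hψ1 : ∀ y, f y = ψ y * f 1 := fun y => by rw [← hψ, mul_one]
  have hcancel : ∀ {a b : B}, a * f 1 = b * f 1 → a = b := fun h => hu.mul_right_cancel h
  let Ψ : A →ₐ[ℚ] B := AlgHom.ofLinearMap
    { toFun := ψ
      map_add' := fun x y => hcancel (by rw [add_mul, ← hψ1, ← hψ1, ← hψ1, map_add])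
      map_smul' := fun q x => hcancel (by
        rw [RingHom.id_apply, smul_mul_assoc, ← hψ1, ← hψ1, map_smul]) }
    (hcancel (by change ψ 1 * f 1 = _; rw [← hψ1, one_mul]))
    fun x y => hcancel (by change ψ (x * y) * f 1 = ψ x * ψ y * f 1; rw [← hψ1, mul_assoc, ← hψ1, hψ])
  refine ⟨AlgEquiv.ofBijective Ψ ⟨fun x y hxy => hf.1 ?_, fun b => ?_⟩⟩
  · rw [hψ1 x, hψ1 y]; exact congrArg (· * f 1) hxy
  · obtain ⟨x, hx⟩ := hf.2 (b * f 1)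
    exact ⟨x, hcancel ((hψ1 x).symm.trans hx)⟩

end Algebras

end AlgAction

theorem mainTheorem4 (R₁ : Type u) (R₂ : Type v) [CommRing R₁] [CommRing R₂]
    [Module.Finite ℤ R₁] [Module.Finite ℤ R₂] [IsAddTorsionFree R₁] [IsAddTorsionFree R₂]
    (h : Nonempty (AlgAction.TopGroupoid.Iso
      (AlgAction.ringGroupoid R₁) (AlgAction.ringGroupoid R₂))) :
    Nonempty ((ℚ ⊗[ℤ] R₁) ≃ₐ[ℚ] (ℚ ⊗[ℤ] R₂)) := by
  obtain ⟨e⟩ := h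
  obtain ⟨f, hf, hmul⟩ := AlgAction.exists_linearMap e
  -- The inverse isomorphism serves only to bound the dimension from the other side.
  obtain ⟨g, hg, -⟩ := AlgAction.exists_linearMap e.symm
  have hdim := le_antisymm (LinearMap.finrank_le_finrank_of_injective hf)
    (LinearMap.finrank_le_finrank_of_injective hg)
  exact AlgAction.nonempty_algEquiv_of_intertwining f
    ⟨hf, (LinearMap.injective_iff_surjective_of_finrank_eq_finrank hdim).1 hf⟩ hmul
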